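/- Let $\Sigma=\{a,b\}$, write $|w|_c$ for the number of occurrences of the letter $c$ in a word $w$ and $|w|$ for its length, and let $\mathsf{SQRT}=\{w\in\{a,b\}^* : |w|_a<|w|/\sqrt2\}$. A ReLU network is a nonempty composition of layers $\mathbb{Q}^m\to\mathbb{Q}^n$ whose output coordinates have the form $x\mapsto\max(0,\beta+\sum_i w_ix_i)$ with rational $\beta,w_i$. An average hard attention (AHA) layer is given by affine maps $Q,K:\mathbb{Q}^d\to\mathbb{Q}^m$, $V:\mathbb{Q}^d\to\mathbb{Q}^k$ and a ReLU network $N:\mathbb{Q}^{d+k}\to\mathbb{Q}^e$; it maps a sequence $(x_1,\dots,x_n)$ to $(y_1,\dots,y_n)$ with $y_i=N(x_i,a_i)$, where $a_i$ is the average of $Vx_j$ over all $j$ for which $\langle Kx_i,Qx_j\rangle$ is maximal. An average hard attention transformer (AHAT) over $\Sigma$ consists of an embedding $\iota:\Sigma\to\mathbb{Q}^{d}$, a positional encoding $p:\mathbb{N}^2\to\mathbb{Q}^{d}$ and a finite sequence of AHA layers; it is a NoPE-AHAT if $p$ is constant. Without end marker, it recognises the set of nonempty words $w=c_1\cdots c_n$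 for which applying the layers in order to $(\iota(c_1)+p(n,1),\dots,\iota(c_n)+p(n,n))$ gives a sequence whose last vector has positive first coordinate. The logic $\mathsf{LTL[Count]}$ has formulas $\varphi::=c\mid t\le t\mid\neg\varphi\mid\varphi\lor\varphi\mid \mathrm{X}\varphi\mid\varphi\,\mathrm{U}\,\varphi$ with $c\in\Sigma$, and terms $t::=k\mid k\cdot\overleftarrow{\#\varphi}\mid k\cdot\overrightarrow{\#\varphi}\mid t+t$ with $k\in\mathbb{Z}$. They are evaluated at positions of finite words in the usual way, where at position $i$ of $w$ the term $k\cdot\overleftarrow{\#\varphi}$ is $k$ times the number of positions $j<i$ satisfying $\varphi$, and $k\cdot\overrightarrow{\#\varphi}$ is $k$ times the number of positions $j$ with $i\le j\le|w|$ satisfying $\varphi$. The language of a formula is the set of nonempty words that satisfy it at their first position. A simplified multicounter machine has a finite state set $S$, a start state $q_0$, finitely many integer counters $z\in\mathbb{Z}^d$, a transition function $\delta:S\times\Sigma\times\{0,1\}^d\to S$, an update function $u$ that assigns to each letter and each counter one of the operations $+1$, $-1$, set to $0$, leave unchanged, and a set $F\subseteq S\times\{0,1\}^d$. Let $\operatorname{mask}(z)\in\{0,1\}^d$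 have $i$-th entry $0$ if and only if $z_i=0$. Reading $c\in\Sigma$ in configuration $(q,z)$ leads to state $\delta(q,c,\operatorname{mask}(z))$ and applies $u(c)$ to the counters. A word is accepted if the run on it from $(q_0,0)$ ends in a configuration $(q,z)$ with $(q,\operatorname{mask}(z))\in F$. Then: 1. $\mathsf{SQRT}$ is recognised without end marker by a NoPE-AHAT with exactly two AHA layers. 2. The Parikh image $\{(|w|_a,|w|_b) : w\in\mathsf{SQRT}\}\subseteq\mathbb{N}^2$ is not semilinear, i.e. not a finite union of sets $v+\{\sum_{i=1}^r n_iv_i : n_i\in\mathbb{N}\}$ with $v,v_1,\dots,v_r\in\mathbb{N}^2$. 3. $\mathsf{SQRT}$ is not the language of any $\mathsf{LTL[Count]}$ formula. 4. $\mathsf{SQRT}$ is not accepted by any simplified multicounter machine. -/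

import Mathlib

namespace CountLang

/-! ### ReLU networks and average hard attention transformers -/

/-- A ReLU node with `m` rational inputs. -/
structure ReLUNode (m : ℕ) where
  weight : Fin m → ℚ
  bias : ℚ

/-- `v(x) = max(0, b + ∑ i, w i * x i)`. -/
def ReLUNode.eval {m : ℕ} (v : ReLUNode m) (x : Fin m → ℚ) : ℚ :=
  max 0 (v.bias + ∑ i, v.weight i * x i)

/-- A ReLU layer: a tuple of `n` ReLU nodes with a common input dimension `m`. -/
abbrev ReLULayer (m n : ℕ) : Type := Fin n → ReLUNode m

/-- The function computed by a ReLU layer. -/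
def ReLULayer.eval {m n : ℕ} (l : ReLULayer m n) (x : Fin m → ℚ) : Fin n → ℚ :=
  fun i => (l i).eval x

/-- A ReLU neural network: a nonempty sequence of ReLU layers with matching dimensions. -/
inductive ReLUNet : ℕ → ℕ → Type
  | single {m n : ℕ} (l : ReLULayer m n) : ReLUNet m n
  | cons {m k n : ℕ} (l : ReLULayer m k) (rest : ReLUNet k n) : ReLUNet m n

/-- The function computed by a ReLU network; the first layer of the sequence is applied first. -/
def ReLUNet.eval : {m n : ℕ} → ReLUNet m n → (Fin m → ℚ) → (Fin n → ℚ)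
  | _, _, .single l, x => ReLULayer.eval l x
  | _, _, .cons l rest, x => rest.eval (ReLULayer.eval l x)

/-- An average hard attention layer with input dimension `d` and output dimension `e`:
affine query, key and value maps, and a ReLU network. -/
structure AHALayer (d e : ℕ) where
  /-- common dimension of keys and queries -/
  keyDim : ℕ
  /-- dimension of the value vectors -/
  valDim : ℕ
  query : (Fin d → ℚ) →ᵃ[ℚ] (Fin keyDim → ℚ)
  key : (Fin d → ℚ) →ᵃ[ℚ] (Fin keyDim → ℚ)
  value : (Fin d → ℚ) →ᵃ[ℚ] (Fin valDim → ℚ)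
  net : ReLUNet (d + valDim) e

namespace AHALayer

variable {d e n : ℕ}

/-- The set of positions `j` for which the score `⟨k i, q j⟩` is maximal. -/
def attended (l : AHALayer d e) (x : Fin n → Fin d → ℚ) (i : Fin n) : Finset (Fin n) :=
  {j | ∀ j', l.key (x i) ⬝ᵥ l.query (x j') ≤ l.key (x i) ⬝ᵥ l.query (x j)}

/-- The attention vector at position `i`: the average of the values at the attended positions. -/
def attention (l : AHALayer d e) (x : Fin n → Fin d → ℚ) (i : Fin n) : Fin l.valDim → ℚ :=
  ((l.attended x i).card : ℚ)⁻¹ • ∑ j ∈ l.attended x i, l.value (x j)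

/-- The function on sequences computed by the layer: `y i = N (x i, a i)`. -/
def eval (l : AHALayer d e) (x : Fin n → Fin d → ℚ) : Fin n → Fin e → ℚ :=
  fun i => l.net.eval (Fin.append (x i) (l.attention x i))

end AHALayer

/-- A finite sequence of AHA layers with matching dimensions. -/
inductive AHAStack : ℕ → ℕ → Type
  | nil {d : ℕ} : AHAStack d d
  | cons {d e f : ℕ} (l : AHALayer d e) (rest : AHAStack e f) : AHAStack d f

/-- The number of attention layers. -/
def AHAStack.length : {d f : ℕ} → AHAStack d f → ℕ
  | _, _, .nil => 0
  | _, _, .cons _ rest => rest.length + 1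

/-- The function on sequences computed by a stack; the first layer is applied first. -/
def AHAStack.eval {n : ℕ} : {d f : ℕ} → AHAStack d f → (Fin n → Fin d → ℚ) → (Fin n → Fin f → ℚ)
  | _, _, .nil, x => x
  | _, _, .cons l rest, x => rest.eval (l.eval x)

/-- An average hard attention transformer over the alphabet `A`. The output dimension is written
`outDim + 1` because acceptance reads the first output coordinate. -/
structure AHAT (A : Type) where
  inDim : ℕ
  outDim : ℕ
  embed : A → Fin inDim → ℚ
  /-- positional encoding `p n i`, for `n` the length of the word and `i` a position counted
  from `1` -/
  posEnc : ℕ → ℕ → Fin inDim → ℚ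
  layers : AHAStack inDim (outDim + 1)

namespace AHAT

variable {A : Type}

/-- The input sequence of vectors: `x i = embed (w i) + p (n, i)`. -/
def input (T : AHAT A) (w : List A) : Fin w.length → Fin T.inDim → ℚ :=
  fun i => T.embed (w.get i) + T.posEnc w.length (i + 1)

/-- The language of a transformer without end marker: the nonempty words for which the first
coordinate of the output vector at the last position is positive. -/
def language (T : AHAT A) : Language A :=
  {w | ∃ h : w ≠ [], 0 < T.layers.eval (T.input w)
    ⟨w.length - 1, Nat.sub_one_lt (mt List.length_eq_zero_iff.mp h)⟩ 0}

/-- The number of attention layers. -/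
def numLayers (T : AHAT A) : ℕ := T.layers.length

/-- No positional encoding: the positional encoding is a constant function. -/
def IsNoPE (T : AHAT A) : Prop := ∃ c, ∀ n i, T.posEnc n i = c

end AHAT

/-! ### Linear temporal logic with counting -/

mutual

/-- Formulas `φ ::= a | t ≤ t | ¬φ | φ ∨ φ | X φ | φ U φ` of `LTL[Count]`. -/
inductive LTLCount (A : Type) : Type
  | letter : A → LTLCount A
  | le : CountTerm A → CountTerm A → LTLCount A
  | neg : LTLCount A → LTLCount A
  | or : LTLCount A → LTLCount A → LTLCount A
  | next : LTLCount A → LTLCount A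
  | until : LTLCount A → LTLCount A → LTLCount A

/-- Terms `t ::= k | k · #←φ | k · #→φ | t + t` with integers `k`. -/
inductive CountTerm (A : Type) : Type
  | const : ℤ → CountTerm A
  | past : ℤ → LTLCount A → CountTerm A
  | future : ℤ → LTLCount A → CountTerm A
  | add : CountTerm A → CountTerm A → CountTerm A

end

open Classical in
mutual

/-- `φ.Sat w i`: the formula `φ` holds in the word `w` at position `i`; positions are counted
from `0`, so they range over `i < w.length`. -/
noncomputable def LTLCount.Sat {A : Type} (w : List A) : LTLCount A → ℕ → Prop
  | .letter a, i => w[i]? = some a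
  | .le s t, i => CountTerm.val w s i ≤ CountTerm.val w t i
  | .neg φ, i => ¬ LTLCount.Sat w φ i
  | .or φ ψ, i => LTLCount.Sat w φ i ∨ LTLCount.Sat w ψ i
  | .next φ, i => i + 1 < w.length ∧ LTLCount.Sat w φ (i + 1)
  | .until φ ψ, i => ∃ j, i ≤ j ∧ j < w.length ∧ LTLCount.Sat w ψ j ∧
      ∀ k, i ≤ k → k < j → LTLCount.Sat w φ k

/-- The value of a counting term at position `i`: `past` counts the positions strictly before `i`,
`future` counts the positions from `i` (inclusive) to the end of the word. -/
noncomputable def CountTerm.val {A : Type} (w : List A) : CountTerm A → ℕ → ℤ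
  | .const k, _ => k
  | .past k φ, i => k * (((Finset.range i).filter fun j => LTLCount.Sat w φ j).card : ℤ)
  | .future k φ, i => k * (((Finset.Ico i w.length).filter fun j => LTLCount.Sat w φ j).card : ℤ)
  | .add s t, i => CountTerm.val w s i + CountTerm.val w t i

end

/-- The language of a formula: the nonempty words satisfying it at their first position. -/
def LTLCount.language {A : Type} (φ : LTLCount A) : Language A :=
  {w | w ≠ [] ∧ φ.Sat w 0}

/-- Definability of a language in `LTL[Count]`. -/
def IsLTLCountDefinable {A : Type} (L : Language A) : Prop :=
  ∃ φ : LTLCount A, φ.language = L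

/-! ### Simplified multicounter machines -/

/-- The counter operations `+1`, `-1`, `·0` and `·1`. -/
inductive CounterOp : Type
  | incr
  | decr
  | reset
  | noop

/-- The effect of an operation on a counter. -/
def CounterOp.apply : CounterOp → ℤ → ℤ
  | .incr, x => x + 1
  | .decr, x => x - 1
  | .reset, _ => 0
  | .noop, x => x

/-- The masking function: `false` marks the zero entries, `true` the nonzero ones. -/
def mask {d : ℕ} (x : Fin d → ℤ) : Fin d → Bool := fun i => decide (x i ≠ 0)

/-- A `d`-dimensional simplified multicounter machine with input alphabet `A` and state set `Q`
(finiteness of `Q` is required in `IsSMCMLanguage`). -/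
structure SMCM (A Q : Type) (d : ℕ) where
  start : Q
  trans : Q → A → (Fin d → Bool) → Q
  update : A → Fin d → CounterOp
  accepting : Set (Q × (Fin d → Bool))

namespace SMCM

variable {A Q : Type} {d : ℕ}

/-- The unique configuration reached from a configuration by reading one letter. -/
def step (M : SMCM A Q d) (c : Q × (Fin d → ℤ)) (a : A) : Q × (Fin d → ℤ) :=
  (M.trans c.1 a (mask c.2), fun i => (M.update a i).apply (c.2 i))

/-- The configuration reached from the start state and zero counters by reading a word. -/
def run (M : SMCM A Q d) (w : List A) : Q × (Fin d → ℤ) :=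
  w.foldl M.step (M.start, 0)

/-- The set of accepted words. -/
def language (M : SMCM A Q d) : Language A :=
  {w | ((M.run w).1, mask (M.run w).2) ∈ M.accepting}

end SMCM

/-- Acceptance of a language by some simplified multicounter machine. -/
def IsSMCMLanguage {A : Type} (L : Language A) : Prop :=
  ∃ (Q : Type) (_ : Finite Q) (d : ℕ) (M : SMCM A Q d), M.language = L

/-! ### Parikh images and the language `SQRT` -/

/-- The Parikh vector of a word: its number of occurrences of each letter. -/
def parikh {A : Type} [DecidableEq A] (w : List A) : A → ℕ := fun c => w.count c

/-- The Parikh image of a language. -/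
def parikhImage {A : Type} [DecidableEq A] (L : Language A) : Set (A → ℕ) :=
  {v | ∃ w ∈ L, parikh w = v}

/-- The two-letter alphabet. -/
inductive Letter : Type
  | a
  | b
  deriving DecidableEq

/-- `SQRT = {w ∈ {a, b}* : |w|_a < |w| / √2}`. -/
def SQRT : Language Letter :=
  {w | (w.count Letter.a : ℝ) < (w.length : ℝ) / Real.sqrt 2}

end CountLang

open Filter

namespace CountLang

lemma mem_SQRT_iff (w : List Letter) :
    w ∈ SQRT ↔ 2 * w.count Letter.a ^ 2 < w.length ^ 2 := by
  change (w.count Letter.a : ℝ) < (w.length : ℝ) / Real.sqrt 2 ↔ _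
  rw [lt_div_iff₀ (by positivity), ← pow_lt_pow_iff_left₀ (by positivity) (by positivity)
    two_ne_zero, mul_pow, Real.sq_sqrt (by norm_num), mul_comm]
  exact_mod_cast Iff.rfl

/-- The word `a ^ k b ^ m`. -/
def block (k m : ℕ) : List Letter := List.replicate k Letter.a ++ List.replicate m Letter.b

lemma block_mem_SQRT_iff (k m : ℕ) : block k m ∈ SQRT ↔ 2 * k ^ 2 < (k + m) ^ 2 := by
  simp [mem_SQRT_iff, block, List.count_replicate]

lemma parikhImage_SQRT :
    parikhImage SQRT = {v | 2 * v Letter.a ^ 2 < (v Letter.a + v Letter.b) ^ 2} := by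
  ext v
  constructor
  · rintro ⟨w, hw, rfl⟩
    have : w.length = w.count Letter.a + w.count Letter.b := by
      clear hw
      induction w with
      | nil => rfl
      | cons c w ih => cases c <;> simp [ih] <;> omega
    simpa [mem_SQRT_iff, parikh, this] using hw
  · intro hv
    refine ⟨block (v Letter.a) (v Letter.b), (block_mem_SQRT_iff _ _).2 hv, ?_⟩
    funext c
    cases c <;> simp [parikh, block, List.count_replicate]

/-! ### Semilinearity -/

open scoped Pointwise

lemma exists_pell (t : ℕ) : ∃ k m : ℕ,
    ((k : ℝ) + m) - √2 * k = (3 - 2 * √2) ^ t := by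
  induction t with
  | zero => exact ⟨0, 1, by simp⟩
  | succ t ih =>
    obtain ⟨k, m, h⟩ := ih
    refine ⟨2 * (k + m) + 3 * k, (k + m) + k, ?_⟩
    rw [pow_succ, ← h]
    have h2 : √2 * √2 = (2 : ℝ) := Real.mul_self_sqrt (by norm_num)
    push_cast
    linear_combination (-2 * (k : ℝ)) * h2

lemma gap_pos_iff (k m : ℕ) :
    0 < ((k : ℝ) + m) - √2 * k ↔ 2 * k ^ 2 < (k + m) ^ 2 := by
  rw [sub_pos, ← pow_lt_pow_iff_left₀ (by positivity) (by positivity) two_ne_zero, mul_pow,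
    Real.sq_sqrt (by norm_num)]
  exact_mod_cast Iff.rfl

/-- The additive functional `v ↦ |v| - √2 * v a`, positive exactly on the Parikh image of
`SQRT`. -/
noncomputable def gap : (Letter → ℕ) →+ ℝ where
  toFun v := ((v Letter.a : ℝ) + v Letter.b) - √2 * v Letter.a
  map_zero' := by simp
  map_add' u v := by simp; ring

lemma mem_parikhImage_SQRT_iff (v : Letter → ℕ) : v ∈ parikhImage SQRT ↔ 0 < gap v := by
  rw [parikhImage_SQRT]
  exact (gap_pos_iff _ _).symm

lemma IsLinearSet.exists_isMinOn {M : Type*} [AddCommMonoid M] {s : Set M} (hs : IsLinearSet s)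
    (g : M →+ ℝ) (hg : ∀ v ∈ s, 0 < g v) : ∃ a ∈ s, ∀ v ∈ s, g a ≤ g v := by
  obtain ⟨a, t, -, rfl⟩ := hs
  have mem : ∀ u ∈ AddSubmonoid.closure t, a + u ∈ a +ᵥ (AddSubmonoid.closure t : Set M) :=
    fun u hu => ⟨u, hu, rfl⟩
  refine ⟨a, by simpa using mem 0 (zero_mem _), ?_⟩
  rintro _ ⟨u, hu, rfl⟩
  simp only [vadd_eq_add, map_add, le_add_iff_nonneg_right]
  by_contra! hneg
  obtain ⟨c, hc⟩ := exists_nat_gt (g a / -g u)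
  rw [div_lt_iff₀ (by linarith)] at hc
  have := hg _ (mem (c • u) (nsmul_mem hu c))
  rw [map_add, map_nsmul, nsmul_eq_mul] at this
  linarith

theorem not_isSemilinearSet_parikhImage_SQRT : ¬ IsSemilinearSet (parikhImage SQRT) := by
  rintro ⟨S, hfin, hlin, hS⟩
  have pos : ∀ s ∈ S, ∀ v ∈ s, 0 < gap v := fun s hs v hv => by
    rw [← mem_parikhImage_SQRT_iff, hS]
    exact ⟨s, hs, hv⟩
  choose! base hbase hmin using fun s (hs : s ∈ S) =>
    IsLinearSet.exists_isMinOn (hlin s hs) gap (pos s hs)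
  have hlim : Tendsto (fun t : ℕ => (3 - 2 * √2 : ℝ) ^ t) atTop (nhds 0) := by
    have h2 : √2 * √2 = (2 : ℝ) := Real.mul_self_sqrt (by norm_num)
    have h0 := Real.sqrt_nonneg 2
    apply tendsto_pow_atTop_nhds_zero_of_lt_one <;> nlinarith
  have hsmall : ∀ᶠ t : ℕ in atTop, ∀ s ∈ S, (3 - 2 * √2 : ℝ) ^ t < gap (base s) := by
    rw [Filter.eventually_all_finite hfin]
    exact fun s hs => hlim.eventually_lt_const (pos s hs _ (hbase s hs))
  obtain ⟨t, ht⟩ := hsmall.exists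
  obtain ⟨k, m, hkm⟩ := exists_pell t
  let v : Letter → ℕ := fun c => c.casesOn k m
  have hv : gap v = (3 - 2 * √2) ^ t := hkm
  have hvm : v ∈ parikhImage SQRT := by
    have h2 : √2 * √2 = (2 : ℝ) := Real.mul_self_sqrt (by norm_num)
    have h0 := Real.sqrt_nonneg 2
    rw [mem_parikhImage_SQRT_iff, hv]
    apply pow_pos
    nlinarith
  rw [hS] at hvm
  obtain ⟨s, hs, hvs⟩ := hvm
  linarith [hmin s hs v hvs, ht s hs]

/-! ### A transformer for `SQRT` -/

/-- An AHA layer with uniform attention to the identity value map. -/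
def uniformLayer {d e : ℕ} (N : ReLUNet (d + d) e) : AHALayer d e where
  keyDim := 0
  valDim := d
  query := AffineMap.const ℚ _ 0
  key := AffineMap.const ℚ _ 0
  value := AffineMap.id ℚ _
  net := N

lemma uniformLayer_eval {d e n : ℕ} (N : ReLUNet (d + d) e) (x : Fin n → Fin d → ℚ) (i : Fin n) :
    (uniformLayer N).eval x i = N.eval (Fin.append (x i) ((n : ℚ)⁻¹ • ∑ j, x j)) := by
  have : (uniformLayer N).attended x i = Finset.univ := by
    ext j
    simp [AHALayer.attended, show ∀ u v : Fin (uniformLayer N).keyDim → ℚ, u ⬝ᵥ v = 0 from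
      fun u v => Finset.sum_empty]
  simp only [AHALayer.eval, AHALayer.attention, this, Finset.card_univ, Fintype.card_fin]
  rfl

/-- A single ReLU node as a network `ℚ² → ℚ`. -/
def nodeNet (p q r : ℚ) : ReLUNet (1 + 1) 1 := .single fun _ => ⟨![p, q], r⟩

lemma nodeNet_eval (p q r : ℚ) (x y : Fin 1 → ℚ) :
    (nodeNet p q r).eval (Fin.append x y) = fun _ => max 0 (r + (p * x 0 + q * y 0)) := by
  funext i
  simp only [nodeNet, ReLUNet.eval, ReLULayer.eval, ReLUNode.eval]
  rw [Fin.sum_univ_add]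
  simp only [Fin.append_left, Fin.append_right, Fin.sum_univ_one]
  rfl

/-- The first layer multiplies the indicator of the letter `a` with the frequency `α` of `a`; the
second one averages these products and outputs `max (0, 1 - 2 α ^ 2)`. -/
def sqrtAHAT : AHAT Letter where
  inDim := 1
  outDim := 0
  embed c := fun _ => if c = Letter.a then 1 else 0
  posEnc _ _ := 0
  layers := .cons (uniformLayer (nodeNet 1 1 (-1))) (.cons (uniformLayer (nodeNet 0 (-2) 1)) .nil)

lemma sum_indicator_get (w : List Letter) :
    ∑ i : Fin w.length, (if w.get i = Letter.a then (1 : ℚ) else 0) = w.count Letter.a := by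
  induction w with
  | nil => simp
  | cons c w ih =>
    erw [Fin.sum_univ_succ, ih]
    cases c <;> simp [add_comm]

lemma sqrtAHAT_eval (w : List Letter) (hw : w ≠ []) (i : Fin w.length) :
    sqrtAHAT.layers.eval (sqrtAHAT.input w) i 0 =
      max 0 (1 - 2 * ((w.count Letter.a : ℚ) / w.length) ^ 2) := by
  have hn : (0 : ℚ) < w.length := by exact_mod_cast List.length_pos_iff.2 hw
  have hle : (w.count Letter.a : ℚ) / w.length ≤ 1 := by
    rw [div_le_one hn]; exact_mod_cast List.count_le_length
  have hnn : 0 ≤ (w.count Letter.a : ℚ) / w.length := by positivity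
  have hsum := sum_indicator_get w
  set α := (w.count Letter.a : ℚ) / w.length with hα
  have hcount : (w.count Letter.a : ℚ) = α * w.length := by rw [hα]; field_simp
  let x : Fin w.length → Fin 1 → ℚ := fun k _ => if w.get k = Letter.a then 1 else 0
  have input : sqrtAHAT.input w = x := by
    funext k c
    exact add_zero _
  have avg : ((w.length : ℚ)⁻¹ • ∑ k, x k) 0 = α := by
    rw [Pi.smul_apply, Finset.sum_apply, smul_eq_mul]
    simp only [x, hsum, hα]
    ring
  have first : (uniformLayer (nodeNet 1 1 (-1))).eval x = fun j _ => x j 0 * α := by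
    funext j c
    rw [uniformLayer_eval, nodeNet_eval, avg]
    simp only [x]
    split_ifs
    · rw [max_eq_right] <;> linarith
    · rw [max_eq_left] <;> linarith
  rw [input]
  change (uniformLayer (nodeNet 0 (-2) 1)).eval
    ((uniformLayer (nodeNet 1 1 (-1))).eval x) i 0 = _
  rw [uniformLayer_eval, nodeNet_eval, first]
  simp only [Pi.smul_apply, Finset.sum_apply, ← Finset.sum_mul, x, hsum, hcount, smul_eq_mul]
  congr 1
  field_simp
  ring

lemma sqrtAHAT_language : sqrtAHAT.language = SQRT := by
  ext w
  rw [mem_SQRT_iff]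
  constructor
  · rintro ⟨hw, h⟩
    erw [sqrtAHAT_eval w hw] at h
    have hn : (0 : ℚ) < w.length := by exact_mod_cast List.length_pos_iff.2 hw
    have h' : 2 * ((w.count Letter.a : ℚ) / w.length) ^ 2 < 1 := by
      rcases lt_max_iff.1 h with h | h
      · exact absurd h (lt_irrefl _)
      · linarith
    rw [div_pow, ← mul_div_assoc, div_lt_one (by positivity)] at h'
    exact_mod_cast h'
  · intro h
    have hw : w ≠ [] := by rintro rfl; simp at h
    have hn : (0 : ℚ) < w.length := by exact_mod_cast List.length_pos_iff.2 hw
    refine ⟨hw, ?_⟩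
    erw [sqrtAHAT_eval w hw]
    have h' : 2 * ((w.count Letter.a : ℚ) / w.length) ^ 2 < 1 := by
      rw [div_pow, ← mul_div_assoc, div_lt_one (by positivity)]
      exact_mod_cast h
    exact lt_max_of_lt_right (by linarith)

/-! ### A family of words close to the boundary of `SQRT` -/

/-- Up to the factor `s !`, the length of the `s`-th test word: the integer next to `√2 * s`, from
above for odd and from below for even `s`. -/
def approx (s : ℕ) : ℕ := Nat.sqrt (2 * s ^ 2) + s % 2

/-- Words whose two exponents are eventually divisible by every positive integer, with
`|w| / |w|_a → √2`, alternating between `SQRT` and its complement. -/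
def testWord (s : ℕ) : List Letter :=
  block (s.factorial * s) (s.factorial * (approx s - s))

lemma le_approx (s : ℕ) : s ≤ approx s :=
  (Nat.le_sqrt.2 (by nlinarith)).trans (Nat.le_add_right _ _)

lemma lt_approx {s : ℕ} (hs : 3 ≤ s) : s < approx s :=
  (Nat.le_sqrt.2 (by nlinarith : (s + 1) * (s + 1) ≤ 2 * s ^ 2)).trans (Nat.le_add_right _ _)

lemma approx_lt {s : ℕ} (hs : 2 ≤ s) : approx s < 2 * s := by
  have h1 : Nat.sqrt (2 * s ^ 2) < 2 * s - 1 := by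
    rw [Nat.sqrt_lt]
    zify [show 1 ≤ 2 * s by omega]
    nlinarith
  have := Nat.mod_lt s two_pos
  unfold approx
  omega

lemma testWord_mem_SQRT_iff (s : ℕ) : testWord s ∈ SQRT ↔ s % 2 = 1 := by
  have hpos := Nat.pow_pos (n := 2) s.factorial_pos
  rw [testWord, block_mem_SQRT_iff, ← Nat.mul_add, Nat.add_sub_cancel' (le_approx s), mul_pow,
    mul_pow, Nat.mul_left_comm, Nat.mul_lt_mul_left hpos, approx]
  rcases Nat.mod_two_eq_zero_or_one s with h | h
  · simpa [h] using Nat.sqrt_le' (2 * s ^ 2)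
  · simpa [h] using Nat.lt_succ_sqrt' (2 * s ^ 2)

/-- Membership of the test words in `SQRT` does not stabilise. -/
lemma not_eventually_testWord :
    ¬ ((∀ᶠ s in atTop, testWord s ∈ SQRT) ∨ ∀ᶠ s in atTop, testWord s ∉ SQRT) := by
  simp only [testWord_mem_SQRT_iff, eventually_atTop]
  rintro (⟨N, h⟩ | ⟨N, h⟩)
  · have := h (2 * N) (by omega)
    omega
  · have := h (2 * N + 1) (by omega)
    omega

/-! ### Simplified multicounter machines -/

lemma exists_iterate_eq {Q : Type*} [Finite Q] (f : Q → Q) :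
    ∃ N > 0, ∀ c ≥ 2, f^[N * c - 1] = f^[2 * N - 1] := by
  obtain ⟨a, p, hp, h⟩ : ∃ a p, 0 < p ∧ f^[a + p] = f^[a] := by
    obtain ⟨a, b, hne, h⟩ := Finite.exists_ne_map_eq_of_infinite fun n : ℕ => f^[n]
    rcases hne.lt_or_gt with hab | hab
    · exact ⟨a, b - a, by omega, by rw [Nat.add_sub_cancel' hab.le]; exact h.symm⟩
    · exact ⟨b, a - b, by omega, by rw [Nat.add_sub_cancel' hab.le]; exact h⟩
  have period : ∀ t ≥ a, ∀ j, f^[t + p * j] = f^[t] := by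
    intro t ht j
    induction j with
    | zero => rfl
    | succ j ih =>
      rw [show t + p * (j + 1) = (t + p * j - a) + (a + p) by rw [Nat.mul_succ]; omega,
        Function.iterate_add, h, ← Function.iterate_add, Nat.sub_add_cancel (by omega), ih]
  refine ⟨p * (a + 1), by positivity, fun c hc => ?_⟩
  obtain ⟨c, rfl⟩ := Nat.exists_eq_add_of_le hc
  have hge : a + 1 ≤ p * (a + 1) := Nat.le_mul_of_pos_left _ hp
  rw [← period (2 * (p * (a + 1)) - 1) (by omega) ((a + 1) * c)]
  congr 1
  rw [Nat.mul_add, mul_comm (p * (a + 1)) 2, ← Nat.mul_assoc p]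
  omega

namespace CounterOp

lemma iterate_incr (t : ℕ) (x : ℤ) : incr.apply^[t] x = x + t := by
  induction t with
  | zero => simp
  | succ t ih => rw [Function.iterate_succ_apply', ih]; simp [apply]; ring

lemma iterate_decr (t : ℕ) (x : ℤ) : decr.apply^[t] x = x - t := by
  induction t with
  | zero => simp
  | succ t ih => rw [Function.iterate_succ_apply', ih]; simp [apply]; ring

lemma iterate_noop (t : ℕ) (x : ℤ) : noop.apply^[t] x = x := by
  induction t with
  | zero => simp
  | succ t ih => rw [Function.iterate_succ_apply', ih]; simp [apply]

lemma iterate_reset {t : ℕ} (ht : 1 ≤ t) (x : ℤ) : reset.apply^[t] x = 0 := by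
  obtain ⟨t, rfl⟩ := Nat.exists_eq_add_of_le' ht
  rw [Function.iterate_succ_apply']
  rfl

/-- Whether iterating an operation makes a zero counter nonzero. -/
def moves : CounterOp → Bool
  | incr | decr => true
  | reset | noop => false

/-- Whether a counter is nonzero after `k` times the first and `t` times the second operation, for
`0 < t < k`. -/
def movesAfter (o : CounterOp) : CounterOp → Bool
  | incr | decr => true
  | reset => false
  | noop => o.moves

lemma iterate_ne_zero_iff (o : CounterOp) {t : ℕ} (ht : 1 ≤ t) :
    o.apply^[t] 0 ≠ 0 ↔ o.moves = true := by
  cases o <;> simp [iterate_incr, iterate_decr, iterate_noop, iterate_reset ht, moves] <;> omega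

lemma iterate_iterate_ne_zero_iff (o o' : CounterOp) {k t : ℕ} (ht : 1 ≤ t) (htk : t < k) :
    o'.apply^[t] (o.apply^[k] 0) ≠ 0 ↔ o.movesAfter o' = true := by
  have hk : 1 ≤ k := by omega
  cases o' <;> cases o <;>
    simp [iterate_incr, iterate_decr, iterate_noop, iterate_reset ht, iterate_reset hk, moves,
      movesAfter] <;> omega

end CounterOp

namespace SMCM

variable {A Q : Type} {d : ℕ} (M : SMCM A Q d)

lemma foldl_replicate (c : A) (t : ℕ) (x : Q × (Fin d → ℤ)) :
    (List.replicate t c).foldl M.step x = (fun y => M.step y c)^[t] x := by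
  induction t generalizing x with
  | zero => rfl
  | succ t ih => rw [List.replicate_succ, List.foldl_cons, ih]; rfl

lemma iterate_step_snd (c : A) (t : ℕ) (x : Q × (Fin d → ℤ)) :
    ((fun y => M.step y c)^[t] x).2 = fun i => (M.update c i).apply^[t] (x.2 i) := by
  induction t with
  | zero => rfl
  | succ t ih =>
    funext i
    rw [Function.iterate_succ_apply', Function.iterate_succ_apply', step, ih]

lemma iterate_step_fst (c : A) (T : ℕ) (x : Q × (Fin d → ℤ)) (μ : Fin d → Bool)
    (hμ : ∀ t, 1 ≤ t → t < T → mask ((fun y => M.step y c)^[t] x).2 = μ) (hT : 1 ≤ T) :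
    ((fun y => M.step y c)^[T] x).1 =
      (fun q => M.trans q c μ)^[T - 1] (M.trans x.1 c (mask x.2)) := by
  obtain ⟨T, rfl⟩ := Nat.exists_eq_add_of_le' hT
  clear hT
  induction T with
  | zero => rfl
  | succ T ih =>
    have := ih fun t h1 h2 => hμ t h1 (by omega)
    rw [Function.iterate_succ_apply', step, this, hμ (T + 1) (by omega) (by omega),
      Nat.add_sub_cancel, Nat.add_sub_cancel]
    exact (Function.iterate_succ_apply' (fun q => M.trans q c μ) T _).symm

/-- The final state and mask stabilise along words `a ^ k b ^ m` with `m < k` whose exponents are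
multiples of a suitable number. -/
lemma exists_run_block_eq [Finite Q] (M : SMCM Letter Q d) :
    ∃ N > 0, ∃ r, ∀ k m : ℕ, 2 * N ∣ k → 2 * N ∣ m → 0 < m → m < k →
      ((M.run (block k m)).1, mask (M.run (block k m)).2) = r := by
  let μ : Fin d → Bool := fun i => (M.update .a i).moves
  let ν : Fin d → Bool := fun i => (M.update .a i).movesAfter (M.update .b i)
  obtain ⟨N₁, hN₁, h₁⟩ := exists_iterate_eq fun q => M.trans q Letter.a μ
  obtain ⟨N₂, hN₂, h₂⟩ := exists_iterate_eq fun q => M.trans q Letter.b ν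
  have key : ∀ {f : Q → Q} {N N' k : ℕ}, 0 < k → 2 * (N * N') ∣ k →
      (∀ c ≥ 2, f^[N * c - 1] = f^[2 * N - 1]) → f^[k - 1] = f^[2 * N - 1] := by
    rintro f N N' _ hk ⟨c, rfl⟩ h
    have : 0 < N' * c := by
      rcases Nat.eq_zero_or_pos (N' * c) with h0 | h0
      · rw [show 2 * (N * N') * c = 2 * N * (N' * c) by ring, h0] at hk
        omega
      · exact h0
    rw [show 2 * (N * N') * c = N * (2 * (N' * c)) by ring, h _ (by omega)]
  refine ⟨N₁ * N₂, by positivity, ((fun q => M.trans q Letter.b ν)^[2 * N₂ - 1]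
    (M.trans ((fun q => M.trans q Letter.a μ)^[2 * N₁ - 1]
      (M.trans M.start Letter.a (mask 0))) Letter.b μ), ν), ?_⟩
  intro k m hk hm hm0 hmk
  have hk0 : 0 < k := by omega
  have maskA : ∀ t, 1 ≤ t →
      mask ((fun y => M.step y Letter.a)^[t] (M.start, 0)).2 = μ := by
    intro t ht
    funext i
    rw [iterate_step_snd, Bool.eq_iff_iff]
    simpa [mask, μ] using (M.update .a i).iterate_ne_zero_iff ht
  set x := (fun y => M.step y Letter.a)^[k] (M.start, 0) with hx
  have maskB : ∀ t, 1 ≤ t → t < k → mask ((fun y => M.step y Letter.b)^[t] x).2 = ν := by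
    intro t ht htk
    funext i
    rw [iterate_step_snd, hx, iterate_step_snd, Bool.eq_iff_iff]
    simpa [mask, ν] using (M.update .a i).iterate_iterate_ne_zero_iff (M.update .b i) ht htk
  have hrun : M.run (block k m) = (fun y => M.step y Letter.b)^[m] x := by
    rw [run, block, List.foldl_append, foldl_replicate, foldl_replicate]
  have hx1 := M.iterate_step_fst Letter.a k (M.start, 0) μ (fun t h _ => maskA t h) hk0
  rw [key hk0 hk h₁, ← hx] at hx1
  rw [hrun, maskB m hm0 hmk,
    M.iterate_step_fst Letter.b m x ν (fun t h1 h2 => maskB t h1 (by omega)) hm0,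
    key hm0 (by rwa [mul_comm N₂]) h₂, hx1, hx, maskA k hk0]

end SMCM

theorem not_isSMCMLanguage_SQRT : ¬ IsSMCMLanguage SQRT := by
  rintro ⟨Q, hQ, d, M, hM⟩
  obtain ⟨N, hN, r, hr⟩ := M.exists_run_block_eq
  have hev : ∀ᶠ s in atTop, (testWord s ∈ SQRT ↔ r ∈ M.accepting) := by
    filter_upwards [eventually_ge_atTop (2 * N), eventually_ge_atTop 3] with s hs hs3
    have hdvd : 2 * N ∣ s.factorial := Nat.dvd_factorial (by omega) hs
    have hpos := s.factorial_pos
    have h1 := lt_approx hs3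
    have h2 := approx_lt (s := s) (by omega)
    rw [← hr _ _ (hdvd.mul_right s) (hdvd.mul_right (approx s - s))
      (Nat.mul_pos hpos (by omega)) (Nat.mul_lt_mul_of_pos_left (by omega) hpos), ← hM]
    rfl
  apply not_eventually_testWord
  by_cases h : r ∈ M.accepting
  · exact Or.inl (hev.mono fun s hs => hs.2 h)
  · exact Or.inr (hev.mono fun s hs => mt hs.1 h)

/-! ### Affine forms in the parameters of the test words -/

/-- An integer sequence that eventually is an affine combination, with rational coefficients, of
the number of letters `a` and the length of the test words. -/
def IsForm (e : ℕ → ℤ) : Prop :=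
  ∃ α β : ℚ, ∃ γ : ℤ, ∀ᶠ s : ℕ in atTop,
    (e s : ℚ) = α * (s.factorial * s) + β * (s.factorial * approx s) + γ

/-- A property of naturals that is eventually constant. -/
def Settled (p : ℕ → Prop) : Prop := (∀ᶠ s in atTop, p s) ∨ ∀ᶠ s in atTop, ¬ p s

lemma Settled.not {p : ℕ → Prop} (h : Settled p) : Settled fun s => ¬ p s :=
  h.symm.imp_right fun h => h.mono fun _ => not_not_intro

lemma Settled.and {p q : ℕ → Prop} (hp : Settled p) (hq : Settled q) :
    Settled fun s => p s ∧ q s := by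
  rcases hp with hp | hp
  · rcases hq with hq | hq
    · exact Or.inl (hp.and hq)
    · exact Or.inr (hq.mono fun _ h h' => h h'.2)
  · exact Or.inr (hp.mono fun _ h h' => h h'.1)

lemma Settled.congr {p q : ℕ → Prop} (hp : Settled p) (h : ∀ᶠ s in atTop, p s ↔ q s) :
    Settled q := by
  rcases hp with hp | hp
  · exact Or.inl (by filter_upwards [hp, h] with s h1 h2 using h2.1 h1)
  · exact Or.inr (by filter_upwards [hp, h] with s h1 h2 using mt h2.2 h1)

lemma abs_approx_sub_le (s : ℕ) : |(approx s : ℝ) - √2 * s| ≤ 1 := by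
  have hs : √((2 * s ^ 2 : ℕ) : ℝ) = √2 * s := by
    push_cast
    rw [Real.sqrt_mul (by norm_num), Real.sqrt_sq (by positivity)]
  have h1 := Real.nat_sqrt_le_real_sqrt (a := 2 * s ^ 2)
  have h2 := Real.real_sqrt_lt_nat_sqrt_succ (a := 2 * s ^ 2)
  rw [hs] at h1 h2
  have h3 : ((s % 2 : ℕ) : ℝ) ≤ 1 := by
    exact_mod_cast Nat.le_of_lt_succ (Nat.mod_lt s two_pos)
  have h4 : (0 : ℝ) ≤ ((s % 2 : ℕ) : ℝ) := by positivity
  rw [approx, Nat.cast_add, abs_le]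
  constructor <;> linarith

namespace IsForm

variable {e e' : ℕ → ℤ}

lemma congr (he : IsForm e) (h : ∀ᶠ s in atTop, e s = e' s) : IsForm e' := by
  obtain ⟨α, β, γ, H⟩ := he
  exact ⟨α, β, γ, by filter_upwards [H, h] with s h1 h2 using h2 ▸ h1⟩

lemma const (c : ℤ) : IsForm fun _ => c := ⟨0, 0, c, by simp⟩

lemma add (he : IsForm e) (he' : IsForm e') : IsForm fun s => e s + e' s := by
  obtain ⟨α, β, γ, H⟩ := he
  obtain ⟨α', β', γ', H'⟩ := he'
  refine ⟨α + α', β + β', γ + γ', ?_⟩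
  filter_upwards [H, H'] with s h h'
  push_cast
  rw [h, h']
  ring

lemma smul (c : ℤ) (he : IsForm e) : IsForm fun s => c * e s := by
  obtain ⟨α, β, γ, H⟩ := he
  refine ⟨c * α, c * β, c * γ, ?_⟩
  filter_upwards [H] with s h
  push_cast
  rw [h]
  ring

lemma sub (he : IsForm e) (he' : IsForm e') : IsForm fun s => e s - e' s :=
  (he.add (he'.smul (-1))).congr (.of_forall fun s => by ring)

lemma eventually_integral (α : ℚ) (v : ℕ → ℕ) :
    ∀ᶠ s : ℕ in atTop, ∃ A : ℤ, (A : ℚ) = α * (s.factorial * v s) := by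
  filter_upwards [eventually_ge_atTop α.den] with s hs
  obtain ⟨c, hc⟩ := Nat.dvd_factorial α.den_pos hs
  refine ⟨α.num * c * v s, ?_⟩
  rw [hc]
  push_cast
  rw [← mul_assoc, ← mul_assoc, Rat.mul_den_eq_num]

lemma ediv (he : IsForm e) {k : ℤ} (hk : 0 < k) : IsForm fun s => e s / k := by
  obtain ⟨α, β, γ, H⟩ := he
  refine ⟨α / k, β / k, γ / k, ?_⟩
  filter_upwards [H, eventually_integral (α / k) id, eventually_integral (β / k) approx]
    with s h ⟨A, hA⟩ ⟨B, hB⟩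
  have hk' : (k : ℚ) ≠ 0 := by exact_mod_cast hk.ne'
  have : e s = γ + k * (A + B) := by
    have : (e s : ℚ) = γ + k * (A + B) := by
      rw [h, hA, hB]
      field_simp
      simp only [id]
      ring
    exact_mod_cast this
  rw [this, Int.add_mul_ediv_left _ _ hk.ne', ← hB]
  simp only [id] at hA
  rw [← hA]
  push_cast
  ring

lemma eventually_pos {α β : ℚ} {γ : ℤ} (h : (0 : ℝ) < α + β * √2)
    (H : ∀ᶠ s : ℕ in atTop,
      (e s : ℚ) = α * (s.factorial * s) + β * (s.factorial * approx s) + γ) :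
    ∀ᶠ s in atTop, 0 < e s := by
  obtain ⟨N, hN⟩ := exists_nat_gt ((|(β : ℝ)| + |(γ : ℝ)|) / (α + β * √2))
  filter_upwards [H, eventually_ge_atTop N] with s hs hsN
  have hfac : (1 : ℝ) ≤ s.factorial := by exact_mod_cast s.factorial_pos
  have hes : (e s : ℝ) = s.factorial * ((α + β * √2) * s + β * (approx s - √2 * s)) + γ := by
    have : (e s : ℝ) = α * (s.factorial * s) + β * (s.factorial * approx s) + γ := by
      exact_mod_cast congrArg (fun q : ℚ => (q : ℝ)) hs
    rw [this]
    ring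
  have h1 : |(β : ℝ)| + |(γ : ℝ)| < (α + β * √2) * s := by
    rw [div_lt_iff₀ h] at hN
    have : (N : ℝ) ≤ s := by exact_mod_cast hsN
    nlinarith
  have h2 : -|(β : ℝ)| ≤ β * (approx s - √2 * s) := by
    have := abs_mul (β : ℝ) (approx s - √2 * s)
    have h3 := mul_le_of_le_one_right (abs_nonneg (β : ℝ)) (abs_approx_sub_le s)
    have h4 := neg_abs_le ((β : ℝ) * (approx s - √2 * s))
    linarith
  have h3 := neg_abs_le (γ : ℝ)
  have h4 := abs_nonneg (γ : ℝ)
  have : (0 : ℝ) < e s := by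
    rw [hes]
    nlinarith
  exact_mod_cast this

lemma trichotomy (he : IsForm e) :
    (∀ᶠ s in atTop, 0 < e s) ∨ (∀ᶠ s in atTop, e s = 0) ∨ ∀ᶠ s in atTop, e s < 0 := by
  obtain ⟨α, β, γ, H⟩ := he
  rcases lt_trichotomy (0 : ℝ) (α + β * √2) with h | h | h
  · exact Or.inl (eventually_pos h H)
  · have hβ : β = 0 := by
      by_contra hβ
      have hβ' : (β : ℝ) ≠ 0 := by exact_mod_cast hβ
      refine irrational_sqrt_two ⟨-α / β, ?_⟩
      push_cast
      field_simp
      linarith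
    have hα : α = 0 := by
      rw [hβ] at h
      simpa using h.symm
    have H' : ∀ᶠ s in atTop, e s = γ := by
      filter_upwards [H] with s hs
      rw [hα, hβ] at hs
      exact_mod_cast (by simpa using hs : (e s : ℚ) = γ)
    rcases lt_trichotomy 0 γ with h | h | h
    · exact Or.inl (H'.mono fun s hs => by omega)
    · exact Or.inr (Or.inl (H'.mono fun s hs => by omega))
    · exact Or.inr (Or.inr (H'.mono fun s hs => by omega))
  · refine Or.inr (Or.inr ?_)
    have := eventually_pos (e := fun s => -e s) (α := -α) (β := -β) (γ := -γ)
      (by push_cast; linarith) (by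
        filter_upwards [H] with s hs
        push_cast
        rw [hs]
        ring)
    exact this.mono fun s hs => by omega

lemma settled_le (he : IsForm e) (he' : IsForm e') : Settled fun s => e s ≤ e' s := by
  rcases (he'.sub he).trichotomy with h | h | h
  · exact Or.inl (h.mono fun s hs => by omega)
  · exact Or.inl (h.mono fun s hs => by omega)
  · exact Or.inr (h.mono fun s hs => by omega)

lemma max (he : IsForm e) (he' : IsForm e') : IsForm fun s => max (e s) (e' s) := by
  rcases he.settled_le he' with h | h
  · exact he'.congr (h.mono fun s hs => by omega)
  · exact he.congr (h.mono fun s hs => by omega)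

lemma toNat (he : IsForm e) : IsForm fun s => ((e s).toNat : ℤ) :=
  (he.max (const 0)).congr (.of_forall fun s => (Int.toNat_eq_max _).symm)

end IsForm

/-! ### Families of sets of positions -/

/-- The families of sets of naturals obtained from half-lines starting at an affine form by
Boolean operations, up to finitely many members of the family. -/
inductive Tame : (ℕ → ℕ → Prop) → Prop
  | thr {e : ℕ → ℤ} (he : IsForm e) : Tame fun s i => e s ≤ i
  | not {S : ℕ → ℕ → Prop} (hS : Tame S) : Tame fun s i => ¬ S s i
  | and {S T : ℕ → ℕ → Prop} (hS : Tame S) (hT : Tame T) : Tame fun s i => S s i ∧ T s i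
  | congr {S T : ℕ → ℕ → Prop} (hS : Tame S) (h : ∀ᶠ s in atTop, ∀ i, S s i ↔ T s i) : Tame T

namespace Tame

variable {S T : ℕ → ℕ → Prop} {e : ℕ → ℤ}

lemma or (hS : Tame S) (hT : Tame T) : Tame fun s i => S s i ∨ T s i :=
  (hS.not.and hT.not).not.congr (.of_forall fun s i => by tauto)

lemma true : Tame fun _ _ => True :=
  (thr (.const 0)).congr (.of_forall fun s i => by simp)

lemma of_settled {p : ℕ → Prop} (hp : Settled p) : Tame fun s _ => p s := by
  rcases hp with hp | hp
  · exact true.congr (hp.mono fun s hs _ => by simp [hs])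
  · exact true.not.congr (hp.mono fun s hs _ => by simp [hs])

lemma shift (hS : Tame S) : Tame fun s i => S s (i + 1) := by
  induction hS with
  | thr he =>
    exact (thr (he.sub (.const 1))).congr (.of_forall fun s i => by push_cast; omega)
  | not _ ih => exact ih.not
  | and _ _ ih ih' => exact ih.and ih'
  | congr _ h ih => exact ih.congr (h.mono fun s hs i => hs _)

lemma settled (hS : Tame S) (he : IsForm e) : Settled fun s => S s (e s).toNat := by
  induction hS with
  | thr he' => exact he'.settled_le he.toNat
  | not _ ih => exact ih.not
  | and _ _ ih ih' => exact ih.and ih'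
  | congr _ h ih => exact ih.congr (h.mono fun s hs => hs _)

lemma exists_mem {E : Set (ℕ → ℤ)} (hE : E.Finite) {S : (ℕ → ℤ) → ℕ → ℕ → Prop}
    (hS : ∀ e ∈ E, Tame (S e)) : Tame fun s i => ∃ e ∈ E, S e s i := by
  induction E, hE using Set.Finite.induction_on with
  | empty => exact true.not.congr (.of_forall fun s i => by simp)
  | @insert e E _ _ ih =>
    exact ((hS e (Set.mem_insert _ _)).or (ih fun e he => hS e (Set.mem_insert_of_mem _ he))).congr
      (.of_forall fun s i => by simp)

lemma forall_mem {E : Set (ℕ → ℤ)} (hE : E.Finite) {S : (ℕ → ℤ) → ℕ → ℕ → Prop}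
    (hS : ∀ e ∈ E, Tame (S e)) : Tame fun s i => ∀ e ∈ E, S e s i :=
  (exists_mem hE fun e he => (hS e he).not).not.congr (.of_forall fun s i => by simp)

/-- Membership in a tame set depends only on the comparison with finitely many breakpoints. -/
lemma exists_breakpoints (hS : Tame S) : ∃ E : Set (ℕ → ℤ), E.Finite ∧ (∀ e ∈ E, IsForm e) ∧
    ∀ᶠ s in atTop, ∀ i j : ℕ, (∀ e ∈ E, e s ≤ i ↔ e s ≤ j) → (S s i ↔ S s j) := by
  induction hS with
  | @thr e he =>
    exact ⟨{e}, Set.finite_singleton e, by simpa using he, .of_forall fun s i j h => h e rfl⟩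
  | not _ ih =>
    obtain ⟨E, h1, h2, h3⟩ := ih
    exact ⟨E, h1, h2, h3.mono fun s hs i j h => not_congr (hs i j h)⟩
  | and _ _ ih ih' =>
    obtain ⟨E, h1, h2, h3⟩ := ih
    obtain ⟨E', h1', h2', h3'⟩ := ih'
    refine ⟨E ∪ E', h1.union h1', fun e he => he.elim (h2 e) (h2' e), ?_⟩
    filter_upwards [h3, h3'] with s hs hs' i j h
    exact and_congr (hs i j fun e he => h e (.inl he)) (hs' i j fun e he => h e (.inr he))
  | congr _ h ih =>
    obtain ⟨E, h1, h2, h3⟩ := ih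
    refine ⟨E, h1, h2, ?_⟩
    filter_upwards [h, h3] with s hs hs' i j hij
    rw [← hs, ← hs, hs' i j hij]

lemma until_iff {s : ℕ} {E : Set (ℕ → ℤ)}
    (hS : ∀ i j : ℕ, (∀ e ∈ E, e s ≤ i ↔ e s ≤ j) → (S s i ↔ S s j))
    (hT : ∀ i j : ℕ, (∀ e ∈ E, e s ≤ i ↔ e s ≤ j) → (T s i ↔ T s j)) (i : ℕ) :
    (∃ j, i ≤ j ∧ T s j ∧ ∀ k, i ≤ k → k < j → S s k) ↔
      T s i ∨ S s i ∧ ∃ e ∈ E, (¬ e s ≤ i ∧ T s (e s).toNat) ∧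
        ∀ e' ∈ E, e' s ≤ i ∨ e s ≤ e' s ∨ S s (e' s).toNat := by
  classical
  constructor
  · rintro ⟨j₀, hij₀, hTj₀, hSj₀⟩
    have hex : ∃ j, i ≤ j ∧ T s j := ⟨j₀, hij₀, hTj₀⟩
    obtain ⟨hij, hTj⟩ := Nat.find_spec hex
    have hmin := fun m => Nat.find_min hex (m := m)
    have hjj₀ := Nat.find_min' hex ⟨hij₀, hTj₀⟩
    set j := Nat.find hex
    rcases hij.eq_or_lt with h | h
    · exact Or.inl (h ▸ hTj)
    refine Or.inr ⟨hSj₀ i le_rfl (by omega), ?_⟩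
    have hne : ¬ (T s (j - 1) ↔ T s j) := fun hiff =>
      hmin (j - 1) (by omega) ⟨by omega, hiff.2 hTj⟩
    have := mt (hT (j - 1) j) hne
    push Not at this
    obtain ⟨e, he, hej⟩ := this
    have hes : e s = j := by omega
    refine ⟨e, he, ⟨by omega, by simpa [hes] using hTj⟩, fun e' _ => ?_⟩
    by_cases h1 : e' s ≤ i
    · exact Or.inl h1
    by_cases h2 : e s ≤ e' s
    · exact Or.inr (Or.inl h2)
    · exact Or.inr (Or.inr (hSj₀ _ (by omega) (by omega)))
  · rintro (h | ⟨hSi, e, he, ⟨hei, hTe⟩, hS'⟩)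
    · exact ⟨i, le_rfl, h, fun k h1 h2 => by omega⟩
    · refine ⟨(e s).toNat, by omega, hTe, fun k hik => ?_⟩
      induction k, hik using Nat.le_induction with
      | base => exact fun _ => hSi
      | succ k hik ih =>
        intro hk
        by_cases hbr : ∃ e' ∈ E, e' s = (k + 1 : ℕ)
        · obtain ⟨e', he', hek⟩ := hbr
          rcases hS' e' he' with h | h | h
          · omega
          · omega
          · simpa [hek] using h
        · push Not at hbr
          refine (hS k (k + 1) fun e' he' => ?_).1 (ih (by omega))
          have := hbr e' he'
          push_cast at this ⊢
          omega

lemma strongUntil (hS : Tame S) (hT : Tame T) :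
    Tame fun s i => ∃ j, i ≤ j ∧ T s j ∧ ∀ k, i ≤ k → k < j → S s k := by
  obtain ⟨E, hE, hform, hES⟩ := hS.exists_breakpoints
  obtain ⟨E', hE', hform', hET⟩ := hT.exists_breakpoints
  have form : ∀ e ∈ E ∪ E', IsForm e := fun e he => he.elim (hform e) (hform' e)
  have : Tame fun s i => T s i ∨ S s i ∧ ∃ e ∈ E ∪ E', (¬ e s ≤ i ∧ T s (e s).toNat) ∧
      ∀ e' ∈ E ∪ E', e' s ≤ i ∨ e s ≤ e' s ∨ S s (e' s).toNat :=
    hT.or <| hS.and <| exists_mem (hE.union hE') fun e he =>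
      ((thr (form e he)).not.and (of_settled (hT.settled (form e he)))).and <|
        forall_mem (hE.union hE') fun e' he' => (thr (form e' he')).or <|
          (of_settled ((form e he).settled_le (form e' he'))).or <|
            of_settled (hS.settled (form e' he'))
  refine this.congr ?_
  filter_upwards [hES, hET] with s h h' i
  exact (until_iff (E := E ∪ E') (fun i j hij => h i j fun e he => hij e (.inl he))
    (fun i j hij => h' i j fun e he => hij e (.inr he)) i).symm

end Tame

/-! ### Counting -/

open Classical in
/-- The integer-valued indicator of a proposition. -/
noncomputable def ind (p : Prop) : ℤ := if p then 1 else 0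

lemma ind_pos {p : Prop} (h : p) : ind p = 1 := if_pos h

lemma ind_neg {p : Prop} (h : ¬ p) : ind p = 0 := if_neg h

lemma ind_not (p : Prop) : ind (¬ p) = 1 + -1 * ind p := by
  by_cases h : p
  · rw [ind_pos h, ind_neg (not_not_intro h)]; rfl
  · rw [ind_neg h, ind_pos h]; rfl

lemma ind_and (p q : Prop) : ind (p ∧ q) = ind p * ind q := by
  by_cases hp : p <;> by_cases hq : q <;> simp [ind, hp, hq]

lemma card_filter_eq_sum_ind (s : Finset ℕ) (p : ℕ → Prop) [DecidablePred p] :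
    ((s.filter p).card : ℤ) = ∑ j ∈ s, ind (p j) := by
  rw [Finset.card_filter]
  push_cast
  exact Finset.sum_congr rfl fun j _ => by by_cases h : p j <;> simp [ind, h]

/-- Families of integer combinations of indicators of half-lines. -/
inductive Step : (ℕ → ℕ → ℤ) → Prop
  | thr {e : ℕ → ℤ} (he : IsForm e) : Step fun s i => ind (e s ≤ i)
  | add {f g : ℕ → ℕ → ℤ} (hf : Step f) (hg : Step g) : Step fun s i => f s i + g s i
  | smul (c : ℤ) {f : ℕ → ℕ → ℤ} (hf : Step f) : Step fun s i => c * f s i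
  | congr {f g : ℕ → ℕ → ℤ} (hf : Step f) (h : ∀ᶠ s in atTop, ∀ i, f s i = g s i) : Step g

lemma Step.mul {f g : ℕ → ℕ → ℤ} (hf : Step f) (hg : Step g) :
    Step fun s i => f s i * g s i := by
  induction hf with
  | thr he =>
    induction hg with
    | thr he' =>
      exact (thr (he.max he')).congr (.of_forall fun s i => by rw [← ind_and, max_le_iff])
    | add _ _ ih ih' => exact (ih.add ih').congr (.of_forall fun s i => by ring)
    | smul c _ ih => exact (ih.smul c).congr (.of_forall fun s i => by ring)
    | congr _ h ih => exact ih.congr (h.mono fun s hs i => by rw [hs])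
  | add _ _ ih ih' => exact (ih.add ih').congr (.of_forall fun s i => by ring)
  | smul c _ ih => exact (ih.smul c).congr (.of_forall fun s i => by ring)
  | congr _ h ih => exact ih.congr (h.mono fun s hs i => by rw [hs])

lemma Tame.step {S : ℕ → ℕ → Prop} (hS : Tame S) : Step fun s i => ind (S s i) := by
  induction hS with
  | thr he => exact .thr he
  | not _ ih =>
    exact ((Step.thr (.const 0)).add (ih.smul (-1))).congr (.of_forall fun s i => by
      rw [ind_not, ind_pos (by positivity)])
  | and _ _ ih ih' => exact (ih.mul ih').congr (.of_forall fun s i => (ind_and _ _).symm)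
  | congr _ h ih => exact ih.congr (h.mono fun s hs i => by rw [hs])

/-- Families of functions that are affine on each of finitely many tame pieces. -/
inductive PiecewiseAffine : (ℕ → ℕ → ℤ) → Prop
  | affine (k : ℤ) {e : ℕ → ℤ} (he : IsForm e) : PiecewiseAffine fun s i => k * i + e s
  | piecewise {S : ℕ → ℕ → Prop} {f g h : ℕ → ℕ → ℤ} (hS : Tame S) (hf : PiecewiseAffine f)
      (hg : PiecewiseAffine g)
      (hh : ∀ᶠ s in atTop, ∀ i, (S s i → f s i = h s i) ∧ (¬ S s i → g s i = h s i)) :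
      PiecewiseAffine h

namespace PiecewiseAffine

variable {f g : ℕ → ℕ → ℤ}

lemma congr (hf : PiecewiseAffine f) (h : ∀ᶠ s in atTop, ∀ i, f s i = g s i) :
    PiecewiseAffine g :=
  .piecewise .true hf hf (h.mono fun _ hs i => ⟨fun _ => hs i, fun _ => hs i⟩)

lemma smul (c : ℤ) (hf : PiecewiseAffine f) : PiecewiseAffine fun s i => c * f s i := by
  induction hf with
  | affine k he =>
    exact (affine (c * k) (he.smul c)).congr (.of_forall fun s i => by ring)
  | piecewise hS _ _ h ih ih' =>
    exact .piecewise hS ih ih' (h.mono fun s hs i =>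
      ⟨fun hi => by rw [(hs i).1 hi], fun hi => by rw [(hs i).2 hi]⟩)

lemma add (hf : PiecewiseAffine f) (hg : PiecewiseAffine g) :
    PiecewiseAffine fun s i => f s i + g s i := by
  induction hf with
  | affine k he =>
    induction hg with
    | affine k' he' =>
      exact (affine (k + k') (he.add he')).congr (.of_forall fun s i => by ring)
    | piecewise hS _ _ h ih ih' =>
      exact .piecewise hS ih ih' (h.mono fun s hs i =>
        ⟨fun hi => by rw [(hs i).1 hi], fun hi => by rw [(hs i).2 hi]⟩)
  | piecewise hS _ _ h ih ih' =>
    exact .piecewise hS ih ih' (h.mono fun s hs i =>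
      ⟨fun hi => by rw [(hs i).1 hi], fun hi => by rw [(hs i).2 hi]⟩)

lemma of_form {e : ℕ → ℤ} (he : IsForm e) : PiecewiseAffine fun s _ => e s :=
  (affine 0 he).congr (.of_forall fun s i => by simp)

lemma tame_nonneg (hf : PiecewiseAffine f) : Tame fun s i => 0 ≤ f s i := by
  induction hf with
  | @affine k e he =>
    rcases lt_trichotomy 0 k with hk | hk | hk
    · refine (Tame.thr ((he.ediv hk).smul (-1))).congr (.of_forall fun s i => ?_)
      have := Int.le_ediv_iff_mul_le (a := -(i : ℤ)) (b := e s) hk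
      constructor
      · intro h
        have := this.1 (by omega)
        linarith
      · intro h
        have := this.2 (by linarith)
        omega
    · exact (Tame.of_settled ((IsForm.const 0).settled_le he)).congr
        (.of_forall fun s i => by simp [← hk])
    · refine (Tame.thr ((he.ediv (k := -k) (by omega)).add (.const 1))).not.congr
        (.of_forall fun s i => ?_)
      have := Int.le_ediv_iff_mul_le (a := (i : ℤ)) (b := e s) (c := -k) (by omega)
      constructor
      · intro h
        have := this.1 (by omega)
        linarith
      · intro h
        have := this.2 (by linarith)
        omega
  | @piecewise S _ _ _ hS _ _ h ih ih' =>
    refine ((hS.and ih).or (hS.not.and ih')).congr (h.mono fun s hs i => ?_)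
    by_cases hi : S s i
    · simp [hi, (hs i).1 hi]
    · simp [hi, (hs i).2 hi]

lemma isForm_eval (hf : PiecewiseAffine f) {e : ℕ → ℤ} (he : IsForm e) :
    IsForm fun s => f s (e s).toNat := by
  induction hf with
  | affine k he' => exact (he.toNat.smul k).add he'
  | piecewise hS _ _ h ih ih' =>
    rcases hS.settled he with hse | hse
    · exact ih.congr (by filter_upwards [h, hse] with s h1 h2 using (h1 _).1 h2)
    · exact ih'.congr (by filter_upwards [h, hse] with s h1 h2 using (h1 _).2 h2)

end PiecewiseAffine

lemma sum_range_ind_le (e : ℤ) (i : ℕ) :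
    ∑ j ∈ Finset.range i, ind (e ≤ j) = if max e 0 ≤ i then i - max e 0 else 0 := by
  induction i with
  | zero =>
    split_ifs <;> simp at * ; omega
  | succ i ih =>
    rw [Finset.sum_range_succ, ih]
    by_cases h : e ≤ i
    · rw [ind_pos h, if_pos (by omega), if_pos (by push_cast; omega)]
      push_cast
      ring
    · rw [ind_neg h, if_neg (by omega)]
      split_ifs with h'
      · push_cast at *
        omega
      · rfl

lemma Step.piecewiseAffine_sum {f : ℕ → ℕ → ℤ} (hf : Step f) :
    PiecewiseAffine fun s i => ∑ j ∈ Finset.range i, f s j := by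
  induction hf with
  | @thr e he =>
    have he' := he.max (.const 0)
    refine .piecewise (Tame.thr he') (.affine 1 (he'.smul (-1))) (.of_form (.const 0))
      (.of_forall fun s i => ?_)
    rw [sum_range_ind_le]
    constructor
    · intro h
      rw [if_pos h]
      ring
    · intro h
      rw [if_neg h]
  | add _ _ ih ih' =>
    exact (ih.add ih').congr (.of_forall fun s i => Finset.sum_add_distrib.symm)
  | smul c _ ih => exact (ih.smul c).congr (.of_forall fun s i => Finset.mul_sum _ _ _)
  | congr _ h ih =>
    exact ih.congr (h.mono fun s hs i => Finset.sum_congr rfl fun j _ => hs j)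

/-! ### Formulas on the test words -/

lemma length_testWord (s : ℕ) : (testWord s).length = s.factorial * approx s := by
  simp only [testWord, block, List.length_append, List.length_replicate]
  rw [← Nat.mul_add, Nat.add_sub_cancel' (le_approx s)]

lemma isForm_length : IsForm fun s => ((testWord s).length : ℤ) :=
  ⟨0, 1, 0, .of_forall fun s => by simp [length_testWord]⟩

lemma isForm_count : IsForm fun s => ((s.factorial * s : ℕ) : ℤ) :=
  ⟨1, 0, 0, .of_forall fun s => by simp⟩

lemma tame_lt_length : Tame fun s i => i < (testWord s).length :=
  (Tame.thr isForm_length).not.congr (.of_forall fun s i => by simp)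

lemma tame_letter (c : Letter) : Tame fun s i => (testWord s)[i]? = some c := by
  cases c with
  | a =>
    refine (Tame.thr isForm_count).not.congr (.of_forall fun s i => ?_)
    rw [Nat.cast_le, not_le, testWord, block, List.getElem?_append]
    simp only [List.length_replicate, List.getElem?_replicate]
    split_ifs <;> simp_all
  | b =>
    refine ((Tame.thr isForm_count).and tame_lt_length).congr (.of_forall fun s i => ?_)
    rw [Nat.cast_le, testWord, block, List.getElem?_append]
    simp only [List.length_replicate, List.getElem?_replicate, List.length_append]
    split_ifs <;> simp_all <;> omega

lemma Tame.piecewiseAffine_past {S : ℕ → ℕ → Prop} (hS : Tame S) [∀ s, DecidablePred (S s)] :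
    PiecewiseAffine fun s i => (((Finset.range i).filter fun j => S s j).card : ℤ) :=
  hS.step.piecewiseAffine_sum.congr (.of_forall fun _ _ => (card_filter_eq_sum_ind _ _).symm)

lemma Tame.piecewiseAffine_future {S : ℕ → ℕ → Prop} (hS : Tame S)
    [∀ s, DecidablePred (S s)] {n : ℕ → ℕ} (hn : IsForm fun s => (n s : ℤ)) :
    PiecewiseAffine fun s i => (((Finset.Ico i (n s)).filter fun j => S s j).card : ℤ) := by
  have hsum := hS.step.piecewiseAffine_sum
  refine .piecewise (Tame.thr hn) (.of_form (.const 0))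
    ((PiecewiseAffine.of_form (hsum.isForm_eval hn)).add (hsum.smul (-1)))
    (.of_forall fun s i => ⟨fun h => ?_, fun h => ?_⟩)
  · rw [Finset.Ico_eq_empty_of_le (by exact_mod_cast h)]
    rfl
  · rw [card_filter_eq_sum_ind, Finset.sum_Ico_eq_sub _ (by omega), Int.toNat_natCast]
    ring

mutual

theorem LTLCount.tame_sat :
    (φ : LTLCount Letter) → Tame fun s i => φ.Sat (testWord s) i
  | .letter c => (tame_letter c).congr (.of_forall fun s i => by rw [LTLCount.Sat])
  | .le t u =>
    (u.piecewiseAffine_val.add (t.piecewiseAffine_val.smul (-1))).tame_nonneg.congr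
      (.of_forall fun s i => by rw [LTLCount.Sat]; constructor <;> intro h <;> linarith)
  | .neg φ => φ.tame_sat.not.congr (.of_forall fun s i => by rw [LTLCount.Sat])
  | .or φ ψ => (φ.tame_sat.or ψ.tame_sat).congr (.of_forall fun s i => by rw [LTLCount.Sat])
  | .next φ => (tame_lt_length.and φ.tame_sat).shift.congr
      (.of_forall fun s i => by rw [LTLCount.Sat])
  | .until φ ψ => (φ.tame_sat.strongUntil (tame_lt_length.and ψ.tame_sat)).congr
      (.of_forall fun s i => by rw [LTLCount.Sat]; simp only [and_assoc])

theorem CountTerm.piecewiseAffine_val :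
    (t : CountTerm Letter) → PiecewiseAffine fun s i => t.val (testWord s) i
  | .const k => (PiecewiseAffine.of_form (.const k)).congr
      (.of_forall fun s i => by rw [CountTerm.val])
  | .past k φ => by
    classical
    exact (φ.tame_sat.piecewiseAffine_past.smul k).congr
      (.of_forall fun s i => by rw [CountTerm.val])
  | .future k φ => by
    classical
    exact ((φ.tame_sat.piecewiseAffine_future isForm_length).smul k).congr
      (.of_forall fun s i => by rw [CountTerm.val])
  | .add t u => (t.piecewiseAffine_val.add u.piecewiseAffine_val).congr
      (.of_forall fun s i => by rw [CountTerm.val])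

end

theorem not_isLTLCountDefinable_SQRT : ¬ IsLTLCountDefinable SQRT := by
  rintro ⟨φ, hφ⟩
  refine not_eventually_testWord ((φ.tame_sat.settled (.const 0)).congr ?_)
  filter_upwards [eventually_ge_atTop 1] with s hs
  have hne : testWord s ≠ [] := by
    rw [← List.length_pos_iff, length_testWord]
    exact Nat.mul_pos s.factorial_pos (hs.trans (le_approx s))
  rw [← hφ]
  exact (and_iff_right hne).symm

end CountLang

theorem mainTheorem7 :
    (∃ T : CountLang.AHAT CountLang.Letter,
      T.IsNoPE ∧ T.numLayers = 2 ∧ T.language = CountLang.SQRT) ∧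
    ¬ IsSemilinearSet (CountLang.parikhImage CountLang.SQRT) ∧
    ¬ CountLang.IsLTLCountDefinable CountLang.SQRT ∧
    ¬ CountLang.IsSMCMLanguage CountLang.SQRT :=
  ⟨⟨CountLang.sqrtAHAT, ⟨0, fun _ _ => rfl⟩, rfl, CountLang.sqrtAHAT_language⟩,
    CountLang.not_isSemilinearSet_parikhImage_SQRT, CountLang.not_isLTLCountDefinable_SQRT,
    CountLang.not_isSMCMLanguage_SQRT⟩
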